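/- Let $V(\rho)=2\cos(4\arctan\rho)=\dfrac{2(1-6\rho^2+\rho^4)}{(1+\rho^2)^2}$. Let $\lambda\in\mathbb{C}$ with $\operatorname{Re}\lambda\ge\frac12$, and let $u\in C^\infty([0,1];\mathbb{C})$ be a function, not identically zero on $[0,1]$, that satisfies the generalized eigenvalue equation $$-(1-\rho^2)u''(\rho)-2\,\frac{1-\rho^2}{\rho}\,u'(\rho)+2\lambda\rho\,u'(\rho)+\frac{V(\rho)}{\rho^2}\,u(\rho)+\lambda(\lambda+1)\,u(\rho)=0\qquad\text{for all }\rho\in(0,1).$$ Then $\lambda=1$ and there exists a nonzero constant $c\in\mathbb{C}$ such that $u(\rho)=\dfrac{c\,\rho}{1+\rho^2}$ for all $\rho\in[0,1]$. -/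

import Mathlib

open scoped ContDiff

/-- The potential `V(ρ) = 2 cos(4 arctan ρ)`. -/
noncomputable def potentialV (ρ : ℝ) : ℝ := 2 * Real.cos (4 * Real.arctan ρ)

/-- The rational form of the potential. -/
theorem potentialV_eq (ρ : ℝ) :
    potentialV ρ = 2 * (1 - 6 * ρ ^ 2 + ρ ^ 4) / (1 + ρ ^ 2) ^ 2 := by
  have h : (1 + ρ ^ 2) ≠ 0 := by positivity
  have e : 4 * Real.arctan ρ = 2 * (2 * Real.arctan ρ) := by ring
  rw [potentialV, e, Real.cos_two_mul, Real.cos_two_mul, Real.cos_sq_arctan]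
  field_simp
  ring

/-- `u` satisfies the eigenvalue equation with spectral parameter `lam` at the point `ρ`:
`-(1-ρ²)u'' - 2((1-ρ²)/ρ)u' + 2λρu' + (V(ρ)/ρ²)u + λ(λ+1)u = 0`.
This is used only at points `ρ` in the open interval `(0,1)`. -/
def SatisfiesEigenvalueODEAt (lam : ℂ) (u : ℝ → ℂ) (ρ : ℝ) : Prop :=
  -(1 - (ρ : ℂ) ^ 2) * deriv (deriv u) ρ
    - 2 * ((1 - (ρ : ℂ) ^ 2) / (ρ : ℂ)) * deriv u ρ
    + 2 * lam * (ρ : ℂ) * deriv u ρ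
    + ((potentialV ρ : ℝ) : ℂ) / (ρ : ℂ) ^ 2 * u ρ
    + lam * (lam + 1) * u ρ = 0

/-- `u` restricted to `[0,1]` is a function in `C^∞[0,1]` (one-sided derivatives of all orders
at the endpoints) that solves the eigenvalue equation. The coefficients are singular at `ρ = 0`,
so the equation is required on the open interval `(0,1)`. The values of `u` outside `[0,1]`
play no role. -/
structure IsSmoothEigenSolution (lam : ℂ) (u : ℝ → ℂ) : Prop where
  smooth : ContDiffOn ℝ ∞ u (Set.Icc 0 1)
  ode : ∀ ρ ∈ Set.Ioo (0 : ℝ) 1, SatisfiesEigenvalueODEAt lam u ρ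

/-! The function `u₀ = ρ / (1 + ρ²)` solves the equation with `λ = 1`. The Darboux transform
`U = (1 - ρ²) (u' - (u₀' / u₀) u) - (λ - 1) ρ u` of a solution `u` solves the same equation with the
potential `2 (3 - ρ²) / (1 + ρ²)`, which is positive and decreasing on `(0,1)`. Physically, `U` is a
self-similar wave in a repulsive potential: when `Re λ ≥ 1/2` the energy flux of `U` through the
rays `ρ = const` is nonincreasing in `ρ`, it vanishes at the centre and it is nonnegative on the
light cone `ρ = 1`, so it vanishes identically and `U = 0`. For an explicit coefficient `b`, the
first order relation `(1 - ρ²) U' = b U + (λ - 1)² u` now forces `λ = 1`, and then `U = 0` says that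
`u / u₀` is constant. -/

open Set Filter Topology

/-- The equation of `SatisfiesEigenvalueODEAt` with `potentialV` replaced by an arbitrary
potential `W`, so that it also covers the Darboux transformed equation. -/
def SatisfiesModeEquationAt (lam : ℂ) (W : ℝ → ℝ) (u : ℝ → ℂ) (ρ : ℝ) : Prop :=
  -(1 - (ρ : ℂ) ^ 2) * deriv (deriv u) ρ
    - 2 * ((1 - (ρ : ℂ) ^ 2) / (ρ : ℂ)) * deriv u ρ
    + 2 * lam * (ρ : ℂ) * deriv u ρ
    + (W ρ : ℂ) / (ρ : ℂ) ^ 2 * u ρ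
    + lam * (lam + 1) * u ρ = 0

theorem satisfiesModeEquationAt_iff {lam : ℂ} {W : ℝ → ℝ} {u : ℝ → ℂ} {ρ : ℝ} (hρ : ρ ≠ 0) :
    SatisfiesModeEquationAt lam W u ρ ↔
      (1 - (ρ : ℂ) ^ 2) * (ρ ^ 2 * deriv (deriv u) ρ + 2 * ρ * deriv u ρ) =
        2 * lam * ρ ^ 3 * deriv u ρ + (W ρ + lam * (lam + 1) * ρ ^ 2) * u ρ := by
  have hc : (ρ : ℂ) ≠ 0 := Complex.ofReal_ne_zero.2 hρ
  rw [SatisfiesModeEquationAt, ← mul_right_inj' (pow_ne_zero 2 hc), mul_zero]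
  field_simp
  constructor <;> intro h <;> linear_combination -h

section EndpointBehaviour

variable {X : Type*} [TopologicalSpace X] {E : Type*} [NormedAddCommGroup E] [NormedSpace ℝ E]
  {g : ℝ → X} {f : ℝ → E} {a b : ℝ}

theorem tendsto_nhdsGT_of_continuousOn_Icc (hab : a < b) (hg : ContinuousOn g (Icc a b)) :
    Tendsto g (𝓝[>] a) (𝓝 (g a)) :=
  (hg a (left_mem_Icc.2 hab.le)).mono_of_mem_nhdsWithin (Icc_mem_nhdsGT hab)

theorem tendsto_nhdsLT_of_continuousOn_Icc (hab : a < b) (hg : ContinuousOn g (Icc a b)) :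
    Tendsto g (𝓝[<] b) (𝓝 (g b)) :=
  (hg b (right_mem_Icc.2 hab.le)).mono_of_mem_nhdsWithin (Icc_mem_nhdsLT hab)

theorem eqOn_Icc_of_eqOn_Ioo [T2Space X] {g' : ℝ → X} (hab : a ≠ b)
    (hg : ContinuousOn g (Icc a b)) (hg' : ContinuousOn g' (Icc a b))
    (h : EqOn g g' (Ioo a b)) : EqOn g g' (Icc a b) :=
  h.of_subset_closure hg hg' Ioo_subset_Icc_self (closure_Ioo hab).ge

theorem eqOn_const_of_antitoneOn_Ioo {φ : ℝ → ℝ} {l m : ℝ} (hφ : AntitoneOn φ (Ioo a b))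
    (ha : Tendsto φ (𝓝[>] a) (𝓝 l)) (hb : Tendsto φ (𝓝[<] b) (𝓝 m)) (hlm : l ≤ m) :
    EqOn φ (fun _ => l) (Ioo a b) := by
  intro z hz
  refine le_antisymm (ge_of_tendsto ha ?_) (hlm.trans (le_of_tendsto hb ?_))
  · filter_upwards [Ioo_mem_nhdsGT hz.1] with t ht
    exact hφ ⟨ht.1, ht.2.trans hz.2⟩ hz ht.2.le
  · filter_upwards [Ioo_mem_nhdsLT hz.2] with t ht
    exact hφ hz ⟨hz.1.trans ht.1, ht.2⟩ ht.1.le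

theorem tendsto_deriv_nhdsWithin_Ioo (hab : a < b) (hf : ContDiffOn ℝ 1 f (Icc a b)) {c : ℝ}
    (hc : c ∈ Icc a b) :
    Tendsto (deriv f) (𝓝[Ioo a b] c) (𝓝 (derivWithin f (Icc a b) c)) := by
  have h := (hf.continuousOn_derivWithin (uniqueDiffOn_Icc hab) le_rfl c hc).mono
    Ioo_subset_Icc_self
  refine h.tendsto.congr' (eventually_of_mem self_mem_nhdsWithin fun x hx => ?_)
  exact derivWithin_of_mem_nhds (Icc_mem_nhds hx.1 hx.2)

theorem tendsto_deriv_nhdsGT (hab : a < b) (hf : ContDiffOn ℝ 1 f (Icc a b)) :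
    Tendsto (deriv f) (𝓝[>] a) (𝓝 (derivWithin f (Icc a b) a)) := by
  simpa only [nhdsWithin_Ioo_eq_nhdsGT hab] using
    tendsto_deriv_nhdsWithin_Ioo hab hf (left_mem_Icc.2 hab.le)

theorem tendsto_deriv_nhdsLT (hab : a < b) (hf : ContDiffOn ℝ 1 f (Icc a b)) :
    Tendsto (deriv f) (𝓝[<] b) (𝓝 (derivWithin f (Icc a b) b)) := by
  simpa only [nhdsWithin_Ioo_eq_nhdsLT hab] using
    tendsto_deriv_nhdsWithin_Ioo hab hf (right_mem_Icc.2 hab.le)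

theorem tendsto_inv_smul_nhdsGT_zero {f' : E} (hf : HasDerivWithinAt f f' (Ioi 0) 0)
    (h0 : f 0 = 0) : Tendsto (fun x : ℝ => x⁻¹ • f x) (𝓝[>] 0) (𝓝 f') := by
  rw [hasDerivWithinAt_iff_tendsto_slope' self_notMem_Ioi] at hf
  simpa [slope_fun_def, h0] using hf

theorem eq_of_tendsto_deriv_of_tendsto_inv_smul {s : Set ℝ} {l m : E} (hs : s ∈ 𝓝[>] (0 : ℝ))
    (hf : DifferentiableOn ℝ f s) (h0 : f 0 = 0) (hl : Tendsto (deriv f) (𝓝[>] 0) (𝓝 l))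
    (hm : Tendsto (fun x : ℝ => x⁻¹ • f x) (𝓝[>] 0) (𝓝 m)) : l = m := by
  have hlim : Tendsto f (𝓝[>] 0) (𝓝 (f 0)) := by
    have h := (tendsto_id.mono_left nhdsWithin_le_nhds : Tendsto id (𝓝[>] (0 : ℝ)) (𝓝 0)).smul hm
    rw [zero_smul, ← h0] at h
    refine h.congr' (eventually_of_mem self_mem_nhdsWithin fun x hx => ?_)
    exact smul_inv_smul₀ (ne_of_gt hx) (f x)
  have hcont : ContinuousWithinAt f (s ∩ Ioi 0) 0 :=
    hlim.mono_left (nhdsWithin_mono 0 inter_subset_right)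
  have hder := hasDerivWithinAt_Ici_of_tendsto_deriv (hf.mono inter_subset_left) hcont
    (inter_mem hs self_mem_nhdsWithin) hl
  exact tendsto_nhds_unique
    (tendsto_inv_smul_nhdsGT_zero (hder.mono Ioi_subset_Ici_self) h0) hm

end EndpointBehaviour

section ValueAtCentre

variable {lam : ℂ} {W : ℝ → ℝ} {W₀ : ℝ} {u : ℝ → ℂ}

theorem tendsto_ofReal_nhdsGT_zero : Tendsto (fun ρ : ℝ => (ρ : ℂ)) (𝓝[>] 0) (𝓝 0) :=
  (Complex.continuous_ofReal.tendsto 0).mono_left nhdsWithin_le_nhds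

theorem hasDerivAt_ofReal (ρ : ℝ) : HasDerivAt (fun x : ℝ => (x : ℂ)) 1 ρ :=
  (hasDerivAt_id ρ).ofReal_comp

theorem one_sub_ofReal_sq_ne_zero {ρ : ℝ} (hρ : ρ ∈ Ioo (0 : ℝ) 1) : 1 - (ρ : ℂ) ^ 2 ≠ 0 := by
  exact_mod_cast (by nlinarith [hρ.1, hρ.2] : (1 - ρ ^ 2 : ℝ) ≠ 0)

theorem hasDerivAt_sq_mul_deriv {ρ : ℝ} (hρ : ρ ∈ Ioo (0 : ℝ) 1)
    (hu' : DifferentiableAt ℝ (deriv u) ρ) (hode : SatisfiesModeEquationAt lam W u ρ) :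
    HasDerivAt (fun x : ℝ => (x : ℂ) ^ 2 * deriv u x)
      ((2 * lam * ρ ^ 3 * deriv u ρ + (W ρ + lam * (lam + 1) * ρ ^ 2) * u ρ) / (1 - (ρ : ℂ) ^ 2))
      ρ := by
  have hid := hasDerivAt_ofReal ρ
  refine ((hid.pow 2).mul hu'.hasDerivAt).congr_deriv ?_
  rw [← (satisfiesModeEquationAt_iff hρ.1.ne').1 hode,
    mul_div_cancel_left₀ _ (one_sub_ofReal_sq_ne_zero hρ)]
  simp only [Pi.pow_apply]
  push_cast
  ring

/-- The limit of `(ρ²u')'` at the centre is `W₀ u(0)`, whereas `ρ²u'` is `o(ρ)`. -/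
theorem apply_zero_eq_zero_of_satisfiesModeEquationAt (hW : Tendsto W (𝓝[>] 0) (𝓝 W₀))
    (hW₀ : W₀ ≠ 0) (hu : ContDiffOn ℝ 1 u (Icc 0 1))
    (hu' : DifferentiableOn ℝ (deriv u) (Ioo 0 1))
    (hode : ∀ ρ ∈ Ioo (0 : ℝ) 1, SatisfiesModeEquationAt lam W u ρ) : u 0 = 0 := by
  have hρ := tendsto_ofReal_nhdsGT_zero
  have hIoo : Ioo (0 : ℝ) 1 ∈ 𝓝[>] (0 : ℝ) := Ioo_mem_nhdsGT one_pos
  have hu0 := tendsto_nhdsGT_of_continuousOn_Icc one_pos hu.continuousOn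
  have hu'0 := tendsto_deriv_nhdsGT one_pos hu
  have hder : ∀ ρ ∈ Ioo (0 : ℝ) 1, HasDerivAt (fun x : ℝ => (x : ℂ) ^ 2 * deriv u x) _ ρ :=
    fun ρ hρ => hasDerivAt_sq_mul_deriv hρ (hu'.differentiableAt (isOpen_Ioo.mem_nhds hρ))
      (hode ρ hρ)
  have hlim : Tendsto (deriv fun x : ℝ => (x : ℂ) ^ 2 * deriv u x) (𝓝[>] 0) (𝓝 (W₀ * u 0)) := by
    refine Tendsto.congr' (eventually_of_mem hIoo fun ρ hρ => (hder ρ hρ).deriv.symm) ?_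
    have hnum := (((hρ.pow 3).const_mul (2 * lam)).mul hu'0).add
      ((hW.ofReal.add ((hρ.pow 2).const_mul (lam * (lam + 1)))).mul hu0)
    simpa [Pi.div_def] using hnum.div ((hρ.pow 2).const_sub 1) (by norm_num)
  have hquot : Tendsto (fun ρ : ℝ => ρ⁻¹ • ((ρ : ℂ) ^ 2 * deriv u ρ)) (𝓝[>] 0) (𝓝 0) := by
    have h := hρ.mul hu'0
    rw [zero_mul] at h
    refine h.congr' (eventually_of_mem self_mem_nhdsWithin fun ρ hρ => ?_)
    have hc : (ρ : ℂ) ≠ 0 := Complex.ofReal_ne_zero.2 (ne_of_gt hρ)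
    simp only [Complex.real_smul, Complex.ofReal_inv]
    field_simp
  have h := eq_of_tendsto_deriv_of_tendsto_inv_smul hIoo
    (fun ρ hρ => (hder ρ hρ).differentiableAt.differentiableWithinAt) (by simp) hlim hquot
  simpa [hW₀] using h

end ValueAtCentre

section Energy

variable {lam : ℂ} {W : ℝ → ℝ} {U : ℝ → ℂ} {ρ : ℝ} {a b : ℂ}

/-- The energy density `r²(ψ_t² + ψ_r²) + Wψ²` of the self-similar wave
`ψ = (T - t)^{-λ} U(r / (T - t))`, in the similarity variable `ρ = r / (T - t)` and without
the power of `T - t`. -/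
noncomputable def energyDensity (lam : ℂ) (W : ℝ → ℝ) (U : ℝ → ℂ) (ρ : ℝ) : ℝ :=
  ρ ^ 2 * (‖lam * U ρ + ρ * deriv U ρ‖ ^ 2 + ‖deriv U ρ‖ ^ 2) + W ρ * ‖U ρ‖ ^ 2

/-- The rate at which the energy `1/2 ∫ energyDensity` leaves the shrinking ball `r < ρ (T - t)`:
the part swept by its boundary, plus the physical flux `-r² ψ_t ψ_r`. -/
noncomputable def energyFlux (lam : ℂ) (W : ℝ → ℝ) (U : ℝ → ℂ) (ρ : ℝ) : ℝ :=
  ρ / 2 * energyDensity lam W U ρ - ρ ^ 2 * inner ℝ (lam * U ρ + ρ * deriv U ρ) (deriv U ρ)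

theorem energyDensity_nonneg (hW : 0 ≤ W ρ) : 0 ≤ energyDensity lam W U ρ := by
  unfold energyDensity
  positivity

theorem hasDerivAt_energyFlux (hρ : ρ ≠ 0) (hW : DifferentiableAt ℝ W ρ)
    (hU : DifferentiableAt ℝ U ρ) (hU' : DifferentiableAt ℝ (deriv U) ρ)
    (hode : SatisfiesModeEquationAt lam W U ρ) :
    HasDerivAt (energyFlux lam W U)
      ((1 - 2 * lam.re) / 2 * energyDensity lam W U ρ + ρ / 2 * deriv W ρ * ‖U ρ‖ ^ 2) ρ := by
  have hid : HasDerivAt (fun x : ℝ => x) 1 ρ := hasDerivAt_id ρ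
  have hN : HasDerivAt (fun x : ℝ => lam * U x + x * deriv U x)
      (lam * deriv U ρ + (1 * deriv U ρ + ρ * deriv (deriv U) ρ)) ρ :=
    (hU.hasDerivAt.const_mul lam).add (hid.ofReal_comp.mul hU'.hasDerivAt)
  have hdensity := ((hid.pow 2).mul (hN.norm_sq.add hU'.hasDerivAt.norm_sq)).add
    (hW.hasDerivAt.mul hU.hasDerivAt.norm_sq)
  have hflux := ((hid.div_const 2).mul hdensity).sub ((hid.pow 2).mul (hN.inner ℝ hU'.hasDerivAt))
  refine HasDerivAt.congr_deriv (f := energyFlux lam W U) hflux ?_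
  have hre := congrArg Complex.re ((satisfiesModeEquationAt_iff hρ).1 hode)
  have him := congrArg Complex.im ((satisfiesModeEquationAt_iff hρ).1 hode)
  simp only [energyDensity, ← Complex.ofReal_pow, ← Complex.ofReal_one, ← Complex.ofReal_sub,
    ← Complex.ofReal_ofNat, Complex.inner, Complex.sq_norm, Complex.normSq_apply,
    Complex.add_re, Complex.add_im, Complex.mul_re, Complex.mul_im, Complex.conj_re,
    Complex.conj_im, Complex.ofReal_re, Complex.ofReal_im, Pi.mul_apply, Pi.add_apply,
    Pi.pow_apply] at hre him ⊢
  linear_combination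
    (-(lam.re * (U ρ).re - lam.im * (U ρ).im + ρ * (deriv U ρ).re)) * hre
      - (lam.re * (U ρ).im + lam.im * (U ρ).re + ρ * (deriv U ρ).im) * him

theorem tendsto_energyFlux_nhdsGT_zero {W₀ : ℝ} (hW : Tendsto W (𝓝[>] 0) (𝓝 W₀))
    (hU : Tendsto U (𝓝[>] 0) (𝓝 0)) (hU' : Tendsto (fun ρ : ℝ => ρ * deriv U ρ) (𝓝[>] 0) (𝓝 0)) :
    Tendsto (energyFlux lam W U) (𝓝[>] 0) (𝓝 0) := by
  have hρ : Tendsto (fun ρ : ℝ => ρ) (𝓝[>] 0) (𝓝 0) := tendsto_id.mono_left nhdsWithin_le_nhds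
  have hN : Tendsto (fun ρ : ℝ => lam * U ρ + ρ * deriv U ρ) (𝓝[>] 0) (𝓝 0) := by
    simpa using (hU.const_mul lam).add hU'
  have h := ((hρ.div_const 2).mul ((((hρ.pow 2).mul (hN.norm.pow 2)).add (hU'.norm.pow 2)).add
    (hW.mul (hU.norm.pow 2)))).sub (hρ.mul (hN.inner hU' (𝕜 := ℝ)))
  simp only [zero_div, zero_mul, sub_zero] at h
  refine h.congr fun ρ => ?_
  simp only [energyFlux, energyDensity, ← Complex.real_smul (x := ρ), real_inner_smul_right,
    norm_smul ρ, mul_pow, Real.norm_eq_abs, sq_abs]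
  ring

theorem tendsto_energyFlux_nhdsLT_one {W₁ : ℝ} (hW : Tendsto W (𝓝[<] 1) (𝓝 W₁))
    (hU : Tendsto U (𝓝[<] 1) (𝓝 a)) (hU' : Tendsto (deriv U) (𝓝[<] 1) (𝓝 b)) :
    Tendsto (energyFlux lam W U) (𝓝[<] 1) (𝓝 ((‖lam * a‖ ^ 2 + W₁ * ‖a‖ ^ 2) / 2)) := by
  have hρ : Tendsto (fun ρ : ℝ => ρ) (𝓝[<] 1) (𝓝 1) := tendsto_id.mono_left nhdsWithin_le_nhds
  have hN := (hU.const_mul lam).add (hρ.ofReal.mul hU')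
  have h : Tendsto (energyFlux lam W U) _ _ :=
    ((hρ.div_const 2).mul (((hρ.pow 2).mul ((hN.norm.pow 2).add (hU'.norm.pow 2))).add
    (hW.mul (hU.norm.pow 2)))).sub ((hρ.pow 2).mul (hN.inner hU' (𝕜 := ℝ)))
  convert h using 2
  have hpolar := norm_sub_sq_real (lam * a + b) b
  rw [add_sub_cancel_right] at hpolar
  rw [Complex.ofReal_one, one_mul, hpolar]
  ring

theorem mode_eqOn_zero_of_repulsive (hlam : 1 / 2 ≤ lam.re) (hW : ContinuousOn W (Icc 0 1))
    (hW1 : 0 ≤ W 1) (hW' : ∀ ρ ∈ Ioo (0 : ℝ) 1, deriv W ρ < 0)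
    (hU : DifferentiableOn ℝ U (Ioo 0 1)) (hU' : DifferentiableOn ℝ (deriv U) (Ioo 0 1))
    (hode : ∀ ρ ∈ Ioo (0 : ℝ) 1, SatisfiesModeEquationAt lam W U ρ)
    (hU0 : Tendsto U (𝓝[>] 0) (𝓝 0)) (hU'0 : Tendsto (fun ρ : ℝ => ρ * deriv U ρ) (𝓝[>] 0) (𝓝 0))
    (hU1 : Tendsto U (𝓝[<] 1) (𝓝 a)) (hU'1 : Tendsto (deriv U) (𝓝[<] 1) (𝓝 b)) :
    EqOn U 0 (Ioo 0 1) := by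
  have hder : ∀ ρ ∈ Ioo (0 : ℝ) 1, HasDerivAt (energyFlux lam W U) _ ρ := fun ρ hρ =>
    hasDerivAt_energyFlux hρ.1.ne' (differentiableAt_of_deriv_ne_zero (hW' ρ hρ).ne)
      (hU.differentiableAt (isOpen_Ioo.mem_nhds hρ))
      (hU'.differentiableAt (isOpen_Ioo.mem_nhds hρ)) (hode ρ hρ)
  have hWanti : StrictAntiOn W (Icc 0 1) :=
    strictAntiOn_of_deriv_neg (convex_Icc 0 1) hW (by rwa [interior_Icc])
  have hgrowth : ∀ ρ ∈ Ioo (0 : ℝ) 1, (1 - 2 * lam.re) / 2 * energyDensity lam W U ρ ≤ 0 :=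
    fun ρ hρ => mul_nonpos_of_nonpos_of_nonneg (by linarith) <| energyDensity_nonneg <|
      hW1.trans (hWanti (Ioo_subset_Icc_self hρ) (right_mem_Icc.2 zero_le_one) hρ.2).le
  have hpot : ∀ ρ ∈ Ioo (0 : ℝ) 1, ρ / 2 * deriv W ρ < 0 := fun ρ hρ =>
    mul_neg_of_pos_of_neg (half_pos hρ.1) (hW' ρ hρ)
  have hanti : AntitoneOn (energyFlux lam W U) (Ioo 0 1) := by
    refine antitoneOn_of_hasDerivWithinAt_nonpos (convex_Ioo 0 1)
      (fun ρ hρ => (hder ρ hρ).continuousAt.continuousWithinAt)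
      (fun ρ hρ => (hder ρ (interior_subset hρ)).hasDerivWithinAt) fun ρ hρ => ?_
    have hρ' := interior_subset hρ
    exact add_nonpos (hgrowth ρ hρ')
      (mul_nonpos_of_nonpos_of_nonneg (hpot ρ hρ').le (sq_nonneg _))
  have hzero : EqOn (energyFlux lam W U) (fun _ => 0) (Ioo 0 1) :=
    eqOn_const_of_antitoneOn_Ioo hanti
      (tendsto_energyFlux_nhdsGT_zero (tendsto_nhdsGT_of_continuousOn_Icc one_pos hW) hU0 hU'0)
      (tendsto_energyFlux_nhdsLT_one (tendsto_nhdsLT_of_continuousOn_Icc one_pos hW) hU1 hU'1)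
      (by positivity)
  intro ρ hρ
  have hsum := (hder ρ hρ).deriv.symm.trans (hzero.deriv isOpen_Ioo hρ)
  rw [deriv_const] at hsum
  by_contra hne
  have := mul_neg_of_neg_of_pos (hpot ρ hρ) (pow_pos (norm_pos_iff.2 hne) 2)
  linarith [hgrowth ρ hρ]

end Energy

section PartnerPotential

/-- The repulsive potential of the supersymmetric partner of the eigenvalue equation. -/
noncomputable def partnerPotential (ρ : ℝ) : ℝ := 2 * (3 - ρ ^ 2) / (1 + ρ ^ 2)

theorem hasDerivAt_partnerPotential (ρ : ℝ) :
    HasDerivAt partnerPotential (-(16 * ρ) / (1 + ρ ^ 2) ^ 2) ρ := by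
  have h : (1 + ρ ^ 2) ≠ 0 := by positivity
  refine ((((hasDerivAt_pow 2 ρ).const_sub 3).const_mul 2).div
    ((hasDerivAt_pow 2 ρ).const_add 1) h).congr_deriv ?_
  field_simp
  push_cast
  ring

theorem deriv_partnerPotential_neg {ρ : ℝ} (hρ : 0 < ρ) : deriv partnerPotential ρ < 0 := by
  rw [(hasDerivAt_partnerPotential ρ).deriv]
  exact div_neg_of_neg_of_pos (by linarith) (by positivity)

end PartnerPotential

section SymmetryMode

/-- The mode with `λ = 1` generated by time translation: `ρ / (1 + ρ²)` is a multiple of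
`ρ d/dρ (2 arctan ρ)`. -/
noncomputable def symmetryMode (ρ : ℝ) : ℂ := ρ / (1 + (ρ : ℂ) ^ 2)

/-- The logarithmic derivative of `symmetryMode`. -/
noncomputable def symmetryLogDeriv (ρ : ℝ) : ℂ := (1 - (ρ : ℂ) ^ 2) / (ρ * (1 + (ρ : ℂ) ^ 2))

theorem one_add_ofReal_sq_ne_zero (ρ : ℝ) : 1 + (ρ : ℂ) ^ 2 ≠ 0 := by
  exact_mod_cast (by positivity : (1 + ρ ^ 2 : ℝ) ≠ 0)

theorem continuous_symmetryMode : Continuous symmetryMode :=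
  Continuous.div (by fun_prop) (by fun_prop) one_add_ofReal_sq_ne_zero

theorem symmetryMode_ne_zero {ρ : ℝ} (hρ : ρ ≠ 0) : symmetryMode ρ ≠ 0 :=
  div_ne_zero (Complex.ofReal_ne_zero.2 hρ) (one_add_ofReal_sq_ne_zero ρ)

theorem hasDerivAt_symmetryMode {ρ : ℝ} (hρ : ρ ≠ 0) :
    HasDerivAt symmetryMode (symmetryLogDeriv ρ * symmetryMode ρ) ρ := by
  have hc : (ρ : ℂ) ≠ 0 := Complex.ofReal_ne_zero.2 hρ
  have h1 := one_add_ofReal_sq_ne_zero ρ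
  have hid := hasDerivAt_ofReal ρ
  refine (hid.div ((hid.pow 2).const_add 1) h1).congr_deriv ?_
  simp only [symmetryLogDeriv, symmetryMode, Pi.pow_apply]
  field_simp
  push_cast
  ring

theorem hasDerivAt_symmetryLogDeriv {ρ : ℝ} (hρ : ρ ≠ 0) :
    HasDerivAt symmetryLogDeriv
      ((ρ ^ 4 - 4 * ρ ^ 2 - 1) / (ρ * (1 + (ρ : ℂ) ^ 2)) ^ 2) ρ := by
  have hc : (ρ : ℂ) ≠ 0 := Complex.ofReal_ne_zero.2 hρ
  have h1 := one_add_ofReal_sq_ne_zero ρ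
  have hid := hasDerivAt_ofReal ρ
  refine (((hid.pow 2).const_sub 1).div (hid.mul ((hid.pow 2).const_add 1))
    (mul_ne_zero hc h1)).congr_deriv ?_
  simp only [Pi.mul_apply, Pi.pow_apply]
  field_simp
  push_cast
  ring

theorem tendsto_ofReal_mul_symmetryLogDeriv :
    Tendsto (fun ρ : ℝ => (ρ : ℂ) * symmetryLogDeriv ρ) (𝓝[>] 0) (𝓝 1) := by
  have hcont : Continuous fun ρ : ℝ => (1 - (ρ : ℂ) ^ 2) / (1 + (ρ : ℂ) ^ 2) :=
    Continuous.div (by fun_prop) (by fun_prop) one_add_ofReal_sq_ne_zero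
  have h := (hcont.tendsto 0).mono_left (nhdsWithin_le_nhds : 𝓝[>] (0 : ℝ) ≤ 𝓝 0)
  simp only [Complex.ofReal_zero, ne_eq, OfNat.ofNat_ne_zero, not_false_eq_true, zero_pow,
    sub_zero, add_zero, div_one] at h
  refine h.congr' (eventually_of_mem self_mem_nhdsWithin fun ρ hρ => ?_)
  have hc : (ρ : ℂ) ≠ 0 := Complex.ofReal_ne_zero.2 (ne_of_gt hρ)
  simp only [symmetryLogDeriv, ← mul_div_assoc, mul_div_mul_left _ _ hc]

end SymmetryMode

section Darboux

variable {lam : ℂ} {u : ℝ → ℂ} {ρ : ℝ}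

/-- The first order operator `u ↦ u₀ (u / u₀)'` that annihilates `u₀ = symmetryMode`. -/
noncomputable def symmetryAnnihilator (u : ℝ → ℂ) (ρ : ℝ) : ℂ :=
  deriv u ρ - symmetryLogDeriv ρ * u ρ

/-- The Darboux transform, which maps solutions of the eigenvalue equation to solutions of the
mode equation with potential `partnerPotential`. -/
noncomputable def darboux (lam : ℂ) (u : ℝ → ℂ) (ρ : ℝ) : ℂ :=
  (1 - (ρ : ℂ) ^ 2) * symmetryAnnihilator u ρ - (lam - 1) * ρ * u ρ

/-- The derivative of `darboux lam u` for a solution `u` of the eigenvalue equation, with the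
second derivative of `u` eliminated. -/
noncomputable def darbouxDeriv (lam : ℂ) (u : ℝ → ℂ) (ρ : ℝ) : ℂ :=
  (lam - 1) * (ρ * deriv u ρ + (lam + 1) * u ρ)
    - (3 + (ρ : ℂ) ^ 2) * symmetryLogDeriv ρ * symmetryAnnihilator u ρ

theorem one_sub_sq_mul_darbouxDeriv (hρ : ρ ≠ 0) :
    (1 - (ρ : ℂ) ^ 2) * darbouxDeriv lam u ρ =
      ((lam - 1) * ρ - (3 + (ρ : ℂ) ^ 2) * symmetryLogDeriv ρ) * darboux lam u ρ
        + (lam - 1) ^ 2 * u ρ := by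
  have hc : (ρ : ℂ) ≠ 0 := Complex.ofReal_ne_zero.2 hρ
  have h1 := one_add_ofReal_sq_ne_zero ρ
  simp only [darbouxDeriv, darboux, symmetryAnnihilator, symmetryLogDeriv]
  field_simp
  ring

theorem hasDerivAt_symmetryAnnihilator (hρ : ρ ≠ 0) (hu : DifferentiableAt ℝ u ρ)
    (hu' : DifferentiableAt ℝ (deriv u) ρ) :
    HasDerivAt (symmetryAnnihilator u)
      (deriv (deriv u) ρ - ((ρ ^ 4 - 4 * ρ ^ 2 - 1) / (ρ * (1 + (ρ : ℂ) ^ 2)) ^ 2 * u ρ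
        + symmetryLogDeriv ρ * deriv u ρ)) ρ :=
  hu'.hasDerivAt.sub ((hasDerivAt_symmetryLogDeriv hρ).mul hu.hasDerivAt)

theorem hasDerivAt_darboux (hρ : ρ ≠ 0) (hu : DifferentiableAt ℝ u ρ)
    (hu' : DifferentiableAt ℝ (deriv u) ρ) (hode : SatisfiesEigenvalueODEAt lam u ρ) :
    HasDerivAt (darboux lam u) (darbouxDeriv lam u ρ) ρ := by
  have hc : (ρ : ℂ) ≠ 0 := Complex.ofReal_ne_zero.2 hρ
  have h1 := one_add_ofReal_sq_ne_zero ρ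
  have hid := hasDerivAt_ofReal ρ
  have h := (((hid.pow 2).const_sub 1).mul (hasDerivAt_symmetryAnnihilator hρ hu hu')).sub
    ((hid.const_mul (lam - 1)).mul hu.hasDerivAt)
  refine h.congr_deriv ?_
  have e := (satisfiesModeEquationAt_iff (W := potentialV) hρ).1 hode
  rw [potentialV_eq] at e
  push_cast at e
  field_simp at e
  simp only [darbouxDeriv, symmetryAnnihilator, symmetryLogDeriv, Pi.pow_apply]
  push_cast
  field_simp
  linear_combination e

theorem hasDerivAt_darbouxDeriv (hρ : ρ ∈ Ioo (0 : ℝ) 1) (hu : DifferentiableAt ℝ u ρ)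
    (hu' : DifferentiableAt ℝ (deriv u) ρ) (hode : SatisfiesEigenvalueODEAt lam u ρ) :
    HasDerivAt (darbouxDeriv lam u)
      (((2 * lam * ρ - 2 * (1 - (ρ : ℂ) ^ 2) / ρ) * darbouxDeriv lam u ρ
        + (partnerPotential ρ / (ρ : ℂ) ^ 2 + lam * (lam + 1)) * darboux lam u ρ)
          / (1 - (ρ : ℂ) ^ 2)) ρ := by
  have hc : (ρ : ℂ) ≠ 0 := Complex.ofReal_ne_zero.2 hρ.1.ne'
  have h1 := one_add_ofReal_sq_ne_zero ρ
  have h2 := one_sub_ofReal_sq_ne_zero hρ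
  have hid := hasDerivAt_ofReal ρ
  have h := (((hid.mul hu'.hasDerivAt).add (hu.hasDerivAt.const_mul (lam + 1))).const_mul
    (lam - 1)).sub ((((hid.pow 2).const_add 3).mul (hasDerivAt_symmetryLogDeriv hρ.1.ne')).mul
      (hasDerivAt_symmetryAnnihilator hρ.1.ne' hu hu'))
  refine h.congr_deriv ?_
  have e := (satisfiesModeEquationAt_iff (W := potentialV) hρ.1.ne').1 hode
  rw [potentialV_eq] at e
  push_cast at e
  field_simp at e
  simp only [darbouxDeriv, darboux, symmetryAnnihilator, symmetryLogDeriv, partnerPotential,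
    Pi.pow_apply, Pi.mul_apply]
  push_cast
  field_simp
  -- The multiplier is the coefficient of `u''` in `(darbouxDeriv lam u)'`, times `ρ (1 + ρ ^ 2)`.
  linear_combination ((lam - 1) * ρ ^ 2 * (1 + (ρ : ℂ) ^ 2)
    - (3 + (ρ : ℂ) ^ 2) * (1 - (ρ : ℂ) ^ 2)) * e

end Darboux

section EigenvalueEquation

variable {lam : ℂ} {u : ℝ → ℂ}

theorem deriv_darboux_eqOn (hu : DifferentiableOn ℝ u (Ioo 0 1))
    (hu' : DifferentiableOn ℝ (deriv u) (Ioo 0 1))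
    (hode : ∀ ρ ∈ Ioo (0 : ℝ) 1, SatisfiesEigenvalueODEAt lam u ρ) :
    EqOn (deriv (darboux lam u)) (darbouxDeriv lam u) (Ioo 0 1) := fun ρ hρ =>
  (hasDerivAt_darboux hρ.1.ne' (hu.differentiableAt (isOpen_Ioo.mem_nhds hρ))
    (hu'.differentiableAt (isOpen_Ioo.mem_nhds hρ)) (hode ρ hρ)).deriv

theorem satisfiesModeEquationAt_darboux (hu : DifferentiableOn ℝ u (Ioo 0 1))
    (hu' : DifferentiableOn ℝ (deriv u) (Ioo 0 1))
    (hode : ∀ ρ ∈ Ioo (0 : ℝ) 1, SatisfiesEigenvalueODEAt lam u ρ) {ρ : ℝ}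
    (hρ : ρ ∈ Ioo (0 : ℝ) 1) :
    SatisfiesModeEquationAt lam partnerPotential (darboux lam u) ρ := by
  have hderiv := deriv_darboux_eqOn hu hu' hode
  have hderiv₂ := (hasDerivAt_darbouxDeriv hρ (hu.differentiableAt (isOpen_Ioo.mem_nhds hρ))
    (hu'.differentiableAt (isOpen_Ioo.mem_nhds hρ)) (hode ρ hρ)).deriv
  rw [SatisfiesModeEquationAt, hderiv.deriv isOpen_Ioo hρ, hderiv hρ, hderiv₂, neg_mul,
    mul_div_cancel₀ _ (one_sub_ofReal_sq_ne_zero hρ)]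
  ring

theorem tendsto_symmetryAnnihilator_nhdsGT_zero (hu : ContDiffOn ℝ 1 u (Icc 0 1)) (h0 : u 0 = 0) :
    Tendsto (symmetryAnnihilator u) (𝓝[>] 0) (𝓝 0) := by
  have hquot := tendsto_inv_smul_nhdsGT_zero
    ((hu.differentiableOn one_ne_zero 0 (left_mem_Icc.2 zero_le_one)).hasDerivWithinAt
      |>.mono_of_mem_nhdsWithin (Icc_mem_nhdsGT one_pos)) h0
  have h := (tendsto_deriv_nhdsGT one_pos hu).sub (tendsto_ofReal_mul_symmetryLogDeriv.mul hquot)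
  rw [one_mul, sub_self] at h
  refine h.congr' (eventually_of_mem self_mem_nhdsWithin fun ρ hρ => ?_)
  have hc : (ρ : ℂ) ≠ 0 := Complex.ofReal_ne_zero.2 (ne_of_gt hρ)
  simp only [symmetryAnnihilator, Complex.real_smul, Complex.ofReal_inv]
  field_simp

theorem tendsto_darboux_nhdsGT_zero (hu : ContDiffOn ℝ 1 u (Icc 0 1)) (h0 : u 0 = 0) :
    Tendsto (darboux lam u) (𝓝[>] 0) (𝓝 0) := by
  have hρ := tendsto_ofReal_nhdsGT_zero
  have h := (((hρ.pow 2).const_sub 1).mul (tendsto_symmetryAnnihilator_nhdsGT_zero hu h0)).sub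
    ((hρ.const_mul (lam - 1)).mul (tendsto_nhdsGT_of_continuousOn_Icc one_pos hu.continuousOn))
  simp only [mul_zero, zero_mul, sub_zero] at h
  exact h

theorem tendsto_mul_darbouxDeriv_nhdsGT_zero (hu : ContDiffOn ℝ 1 u (Icc 0 1)) (h0 : u 0 = 0) :
    Tendsto (fun ρ : ℝ => ρ * darbouxDeriv lam u ρ) (𝓝[>] 0) (𝓝 0) := by
  have hρ := tendsto_ofReal_nhdsGT_zero
  have h := ((hρ.const_mul (lam - 1)).mul ((hρ.mul (tendsto_deriv_nhdsGT one_pos hu)).add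
    ((tendsto_nhdsGT_of_continuousOn_Icc one_pos hu.continuousOn).const_mul (lam + 1)))).sub
    ((((hρ.pow 2).const_add 3).mul tendsto_ofReal_mul_symmetryLogDeriv).mul
      (tendsto_symmetryAnnihilator_nhdsGT_zero hu h0))
  simp only [mul_zero, zero_mul, sub_zero] at h
  refine h.congr fun ρ => ?_
  simp only [darbouxDeriv]
  ring

theorem exists_tendsto_darboux_nhdsLT_one (hu : ContDiffOn ℝ 1 u (Icc 0 1)) :
    (∃ a, Tendsto (darboux lam u) (𝓝[<] 1) (𝓝 a)) ∧
      ∃ b, Tendsto (darbouxDeriv lam u) (𝓝[<] 1) (𝓝 b) := by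
  have hρ : Tendsto (fun ρ : ℝ => (ρ : ℂ)) (𝓝[<] 1) (𝓝 1) :=
    (Complex.continuous_ofReal.tendsto 1).mono_left nhdsWithin_le_nhds
  have hu1 := tendsto_nhdsLT_of_continuousOn_Icc one_pos hu.continuousOn
  have hu'1 := tendsto_deriv_nhdsLT one_pos hu
  have hlog := (hasDerivAt_symmetryLogDeriv one_ne_zero).continuousAt.tendsto.mono_left
    (nhdsWithin_le_nhds : 𝓝[<] (1 : ℝ) ≤ 𝓝 1)
  have hann := hu'1.sub (hlog.mul hu1)
  exact ⟨⟨_, (((hρ.pow 2).const_sub 1).mul hann).sub ((hρ.const_mul (lam - 1)).mul hu1)⟩,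
    ⟨_, (((hρ.mul hu'1).add (hu1.const_mul (lam + 1))).const_mul (lam - 1)).sub
      ((((hρ.pow 2).const_add 3).mul hlog).mul hann)⟩⟩

theorem differentiableOn_darboux (hu : DifferentiableOn ℝ u (Ioo 0 1))
    (hu' : DifferentiableOn ℝ (deriv u) (Ioo 0 1))
    (hode : ∀ ρ ∈ Ioo (0 : ℝ) 1, SatisfiesEigenvalueODEAt lam u ρ) :
    DifferentiableOn ℝ (darboux lam u) (Ioo 0 1) := fun ρ hρ =>
  (hasDerivAt_darboux hρ.1.ne' (hu.differentiableAt (isOpen_Ioo.mem_nhds hρ))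
    (hu'.differentiableAt (isOpen_Ioo.mem_nhds hρ)) (hode ρ hρ)).differentiableAt
    |>.differentiableWithinAt

theorem differentiableOn_deriv_darboux (hu : DifferentiableOn ℝ u (Ioo 0 1))
    (hu' : DifferentiableOn ℝ (deriv u) (Ioo 0 1))
    (hode : ∀ ρ ∈ Ioo (0 : ℝ) 1, SatisfiesEigenvalueODEAt lam u ρ) :
    DifferentiableOn ℝ (deriv (darboux lam u)) (Ioo 0 1) := by
  refine DifferentiableOn.congr (fun ρ hρ => ?_) (deriv_darboux_eqOn hu hu' hode)
  exact (hasDerivAt_darbouxDeriv hρ (hu.differentiableAt (isOpen_Ioo.mem_nhds hρ))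
    (hu'.differentiableAt (isOpen_Ioo.mem_nhds hρ))
    (hode ρ hρ)).differentiableAt.differentiableWithinAt

theorem tendsto_potentialV_nhdsGT_zero : Tendsto potentialV (𝓝[>] 0) (𝓝 2) := by
  have hcont : Continuous potentialV := by
    unfold potentialV
    fun_prop
  have hlim : Tendsto potentialV (𝓝[>] 0) (𝓝 (potentialV 0)) :=
    (hcont.tendsto 0).mono_left nhdsWithin_le_nhds
  simpa only [potentialV, Real.arctan_zero, mul_zero, Real.cos_zero, mul_one] using hlim

theorem darboux_eqOn_zero (hlam : 1 / 2 ≤ lam.re) (hu : ContDiffOn ℝ 1 u (Icc 0 1))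
    (hu' : DifferentiableOn ℝ (deriv u) (Ioo 0 1))
    (hode : ∀ ρ ∈ Ioo (0 : ℝ) 1, SatisfiesEigenvalueODEAt lam u ρ) :
    EqOn (darboux lam u) 0 (Ioo 0 1) := by
  have h0 : u 0 = 0 := apply_zero_eq_zero_of_satisfiesModeEquationAt
    tendsto_potentialV_nhdsGT_zero two_ne_zero hu hu' hode
  have hud : DifferentiableOn ℝ u (Ioo 0 1) :=
    (hu.differentiableOn one_ne_zero).mono Ioo_subset_Icc_self
  have hderiv := deriv_darboux_eqOn hud hu' hode
  have hderiv0 : Tendsto (fun ρ : ℝ => ρ * deriv (darboux lam u) ρ) (𝓝[>] 0) (𝓝 0) := by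
    refine (tendsto_mul_darbouxDeriv_nhdsGT_zero (lam := lam) hu h0).congr'
      (eventually_of_mem (Ioo_mem_nhdsGT one_pos) fun ρ hρ => ?_)
    exact congrArg ((ρ : ℂ) * ·) (hderiv hρ).symm
  obtain ⟨⟨a, ha⟩, b, hb⟩ := exists_tendsto_darboux_nhdsLT_one (lam := lam) hu
  have hderiv1 : Tendsto (deriv (darboux lam u)) (𝓝[<] 1) (𝓝 b) :=
    hb.congr' (eventually_of_mem (Ioo_mem_nhdsLT one_pos) hderiv.symm)
  exact mode_eqOn_zero_of_repulsive hlam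
    (fun ρ _ => (hasDerivAt_partnerPotential ρ).continuousAt.continuousWithinAt)
    (by norm_num [partnerPotential]) (fun ρ hρ => deriv_partnerPotential_neg hρ.1)
    (differentiableOn_darboux hud hu' hode) (differentiableOn_deriv_darboux hud hu' hode)
    (fun ρ hρ => satisfiesModeEquationAt_darboux hud hu' hode hρ)
    (tendsto_darboux_nhdsGT_zero hu h0) hderiv0 ha hderiv1

theorem exists_eq_const_mul_symmetryMode (hu : DifferentiableOn ℝ u (Ioo 0 1))
    (hann : EqOn (symmetryAnnihilator u) 0 (Ioo 0 1)) :
    ∃ c : ℂ, EqOn u (fun ρ => c * symmetryMode ρ) (Ioo 0 1) := by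
  have hder : ∀ ρ ∈ Ioo (0 : ℝ) 1, HasDerivAt (u / symmetryMode) 0 ρ := fun ρ hρ => by
    have hu₀ := symmetryMode_ne_zero hρ.1.ne'
    refine ((hu.differentiableAt (isOpen_Ioo.mem_nhds hρ)).hasDerivAt.div
      (hasDerivAt_symmetryMode hρ.1.ne') hu₀).congr_deriv ?_
    rw [sub_eq_zero.1 (hann hρ)]
    ring
  obtain ⟨c, hc⟩ := isOpen_Ioo.exists_is_const_of_deriv_eq_zero isPreconnected_Ioo
    (fun ρ hρ => (hder ρ hρ).differentiableAt.differentiableWithinAt)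
    (fun ρ hρ => (hder ρ hρ).deriv)
  exact ⟨c, fun ρ hρ => (div_eq_iff (symmetryMode_ne_zero hρ.1.ne')).1 (hc ρ hρ)⟩

theorem sub_one_sq_mul_eq_zero_of_darboux_eqOn_zero (hu : DifferentiableOn ℝ u (Ioo 0 1))
    (hu' : DifferentiableOn ℝ (deriv u) (Ioo 0 1))
    (hode : ∀ ρ ∈ Ioo (0 : ℝ) 1, SatisfiesEigenvalueODEAt lam u ρ)
    (hzero : EqOn (darboux lam u) 0 (Ioo 0 1)) {ρ : ℝ} (hρ : ρ ∈ Ioo (0 : ℝ) 1) :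
    (lam - 1) ^ 2 * u ρ = 0 := by
  have hderiv : darbouxDeriv lam u ρ = 0 := by
    rw [← deriv_darboux_eqOn hu hu' hode hρ, hzero.deriv isOpen_Ioo hρ, deriv_zero, Pi.zero_apply]
  have h := one_sub_sq_mul_darbouxDeriv (lam := lam) (u := u) hρ.1.ne'
  rw [hderiv, hzero hρ, mul_zero, Pi.zero_apply, mul_zero, zero_add] at h
  exact h.symm

end EigenvalueEquation

theorem proposition3p2_general {lam : ℂ} {u : ℝ → ℂ} (hu : ContDiffOn ℝ 1 u (Icc 0 1))
    (hu' : DifferentiableOn ℝ (deriv u) (Ioo 0 1))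
    (hode : ∀ ρ ∈ Ioo (0 : ℝ) 1, SatisfiesEigenvalueODEAt lam u ρ)
    (hnontrivial : ∃ ρ ∈ Icc (0 : ℝ) 1, u ρ ≠ 0) (hlam : 1 / 2 ≤ lam.re) :
    lam = 1 ∧ ∃ c : ℂ, c ≠ 0 ∧
      ∀ ρ ∈ Icc (0 : ℝ) 1, u ρ = c * (ρ : ℂ) / (1 + (ρ : ℂ) ^ 2) := by
  obtain ⟨ρ₀, hρ₀, hne⟩ := hnontrivial
  have hud : DifferentiableOn ℝ u (Ioo 0 1) :=
    (hu.differentiableOn one_ne_zero).mono Ioo_subset_Icc_self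
  have hzero := darboux_eqOn_zero hlam hu hu' hode
  obtain rfl : lam = 1 := by
    by_contra hne_one
    have hu0 : EqOn u 0 (Ioo 0 1) := fun ρ hρ =>
      (mul_eq_zero_iff_left (pow_ne_zero 2 (sub_ne_zero.2 hne_one))).1
        (sub_one_sq_mul_eq_zero_of_darboux_eqOn_zero hud hu' hode hzero hρ)
    exact hne (eqOn_Icc_of_eqOn_Ioo zero_ne_one hu.continuousOn continuousOn_const hu0 hρ₀)
  have hann : EqOn (symmetryAnnihilator u) 0 (Ioo 0 1) := fun ρ hρ => by
    simpa [darboux, one_sub_ofReal_sq_ne_zero hρ] using hzero hρ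
  obtain ⟨c, hc⟩ := exists_eq_const_mul_symmetryMode hud hann
  have hmode : EqOn u (fun ρ => c * symmetryMode ρ) (Icc 0 1) :=
    eqOn_Icc_of_eqOn_Ioo zero_ne_one hu.continuousOn
      (continuous_symmetryMode.const_mul c).continuousOn hc
  refine ⟨rfl, c, ?_, fun ρ hρ => (hmode hρ).trans (mul_div_assoc _ _ _).symm⟩
  rintro rfl
  exact hne ((hmode hρ₀).trans (zero_mul _))

theorem proposition3p2 (lam : ℂ) (u : ℝ → ℂ)
    (hu : IsSmoothEigenSolution lam u)
    (hnontrivial : ∃ ρ ∈ Set.Icc (0 : ℝ) 1, u ρ ≠ 0)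
    (hlam : 1 / 2 ≤ lam.re) :
    lam = 1 ∧ ∃ c : ℂ, c ≠ 0 ∧
      ∀ ρ ∈ Set.Icc (0 : ℝ) 1, u ρ = c * (ρ : ℂ) / (1 + (ρ : ℂ) ^ 2) := by
  have hderiv : DifferentiableOn ℝ (deriv u) (Ioo 0 1) :=
    (hu.smooth.mono Ioo_subset_Icc_self).deriv_of_isOpen isOpen_Ioo (m := 1) (by decide)
      |>.differentiableOn one_ne_zero
  exact proposition3p2_general (hu.smooth.of_le (by decide)) hderiv hu.ode hnontrivial hlam
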